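/- Let $G$ be a countable directed graph with vertex set $V$, edge set $E$ and source and range maps $s,r:E\to V$ (loops and multiple edges allowed). Let $P(G)$ be the set of infinite paths $(x_i)_{i\ge 1}$, $r(x_i)=s(x_{i+1})$; let $P_f(G)$ be the set of finite paths, vertices being the paths of length $0$; and let $Q(G)\subseteq P_f(G)$ be the set of finite paths ending at a vertex that emits no edge or infinitely many edges. Put $\Omega_G=P(G)\cup Q(G)$, with the topology that has as basis the sets $Z(\nu)\setminus\bigcup_{\mu\in M}Z(\mu)$, where $\nu\in P_f(G)$, $M\subseteq P_f(G)$ is finite and $Z(\mu)\subseteq\Omega_G$ is the set of paths with initial segment $\mu$. Let $\mathcal G$ be the étale groupoid of $G$, consisting of the triples $(\mu x,|\mu|-|\mu'|,\mu'x)$ with $\mu,\mu'\in P_f(G)$, $x\in\Omega_G$, $r(\mu)=r(\mu')=s(x)$; such a triple has range $\mu x$ and source $\mu'x$, and the topology of $\mathcal G$ has as basis the sets $\{(\mu x,|\mu|-|\mu'|,\mu'x):\mu x\in U,\ \mu'x\in U'\}$, where $\mu,\mu'\in P_f(G)$, $r(\mu)=r(\mu')$, and $U=Z(\mu)\setminus\bigcup_{\nu\in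 M}Z(\nu)$, $U'=Z(\mu')\setminus\bigcup_{\nu\in M'}Z(\nu)$ with $M,M'\subseteq P_f(G)$ finite. Let $F:E\to\mathbb R$ and $\beta\in\mathbb R$. Extend $F$ additively to $P_f(G)$, with $F(v)=0$ for $v\in V$, and put $c_F(\mu x,|\mu|-|\mu'|,\mu'x)=F(\mu)-F(\mu')$. A $\beta$-KMS measure is a regular Borel measure $m$ on $\Omega_G$ such that $$m(s(W))=\int_{r(W)}e^{\beta c_F(r_W^{-1}(x))}\,dm(x)$$ for every open bisection $W\subseteq\mathcal G$ (an open set on which the range map $r$ and the source map $s$ of $\mathcal G$ are injective; $r_W^{-1}$ is the inverse of $r:W\to r(W)$). It is harmonic if $m(Q(G))=0$. A harmonic $\beta$-KMS measure $m$ is conservative if $m$-almost every $x\in P(G)$ satisfies, for every edge $e$, $x_i=e$ for infinitely many $i$; it is dissipative if $m$-almost every $x\in P(G)$ satisfies, for every vertex $v$, $s(x_i)=v$ for only finitely many $i$. Let $A(\beta)$ be the matrix over $V$ with entries $A(\beta)_{uw}=\sum_{s(e)=u,\,r(e)=w}e^{-\beta F(e)}\in[0,\infty]$; its powers are formed with the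 convention $0\cdot\infty=0$, and $A(\beta)^0$ is the identity matrix. $A(\beta)$ is recurrent if $\sum_{n=0}^\infty A(\beta)^n_{vv}=\infty$ for some $v\in V$, and transient if $\sum_{n=0}^\infty A(\beta)^n_{vv}<\infty$ for some $v\in V$. Theorem (Hopf dichotomy). Assume that $G$ is strongly connected, i.e. for all $v,w\in V$ there is a finite path from $v$ to $w$. Let $m$ be a non-zero harmonic $\beta$-KMS measure. Then $m$ is conservative if and only if $A(\beta)$ is recurrent, and $m$ is dissipative if and only if $A(\beta)$ is transient. -/

import Mathlib

open MeasureTheory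
open scoped ENNReal

/-- A directed graph with vertex set `V` and edge set `E`; loops and multiple edges are allowed.
`s e` is the source and `r e` the range of the edge `e`. -/
structure DirectedGraph (V E : Type*) where
  s : E → V
  r : E → V

namespace DirectedGraph

variable {V E : Type*}

/-- `G.IsWalk v l w`: the list of edges `l` is composable, starts at `v` and ends at `w`.
The empty list is the path of length `0` at `v = w`. -/
def IsWalk (G : DirectedGraph V E) : V → List E → V → Prop
  | v, [], w => v = w
  | v, e :: l, w => G.s e = v ∧ G.IsWalk (G.r e) l w

/-- Finite paths. A vertex `v` is the path of length `0` with source and target `v`. -/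
@[ext]
structure FinitePath (G : DirectedGraph V E) where
  source : V
  edges : List E
  /-- the range of the path -/
  target : V
  isWalk : G.IsWalk source edges target

/-- Infinite paths. -/
@[ext]
structure InfinitePath (G : DirectedGraph V E) where
  edges : ℕ → E
  chain : ∀ i, G.r (edges i) = G.s (edges (i + 1))

/-- Every two vertices `v, w` are joined by a finite path (possibly of length `0`)
from `v` to `w`. -/
def StronglyConnected (G : DirectedGraph V E) : Prop :=
  ∀ v w : V, ∃ μ : G.FinitePath, μ.source = v ∧ μ.target = w

/-- The set of sinks and infinite emitters. -/
def singularVertices (G : DirectedGraph V E) : Set V :=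
  {v | {e : E | G.s e = v} = ∅ ∨ {e : E | G.s e = v}.Infinite}

/-- The space `Ω_G`: infinite paths together with the finite paths that end in a sink or an
infinite emitter. -/
inductive BoundaryPath (G : DirectedGraph V E) where
  | infinite (p : G.InfinitePath) : BoundaryPath G
  | finite (p : G.FinitePath) (hp : p.target ∈ G.singularVertices) : BoundaryPath G

variable {G : DirectedGraph V E}

/-- The length of a finite path. -/
def FinitePath.length (μ : G.FinitePath) : ℕ := μ.edges.length

/-- The source of an infinite path. -/
def InfinitePath.source (p : G.InfinitePath) : V := G.s (p.edges 0)

/-- The source of an element of `Ω_G`. -/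
def BoundaryPath.source : G.BoundaryPath → V
  | .infinite p => p.source
  | .finite p _ => p.source

/-- The `i`-th edge (counted from `0`) of an element of `Ω_G`, or `none` if there is none. -/
def BoundaryPath.edge? : G.BoundaryPath → ℕ → Option E
  | .infinite p, i => some (p.edges i)
  | .finite p _, i => p.edges[i]?

theorem IsWalk.append {l l' : List E} {u v w : V} (h : G.IsWalk u l v) (h' : G.IsWalk v l' w) :
    G.IsWalk u (l ++ l') w := by
  induction l generalizing u with
  | nil => cases h; exact h'
  | cons e l ih => exact ⟨h.1, ih h.2⟩

/-- The sequence of edges `l` followed by the sequence `x`. -/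
def appendSeq (l : List E) (x : ℕ → E) (i : ℕ) : E :=
  if h : i < l.length then l[i] else x (i - l.length)

theorem appendSeq_nil (x : ℕ → E) : appendSeq [] x = x := by
  funext i; simp [appendSeq]

theorem appendSeq_cons_zero (e : E) (l : List E) (x : ℕ → E) :
    appendSeq (e :: l) x 0 = e := by
  simp [appendSeq]

theorem appendSeq_cons_succ (e : E) (l : List E) (x : ℕ → E) (i : ℕ) :
    appendSeq (e :: l) x (i + 1) = appendSeq l x i := by
  simp [appendSeq]

theorem IsWalk.appendSeq_source {l : List E} {u v : V} (h : G.IsWalk u l v) (x : ℕ → E)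
    (hv : v = G.s (x 0)) : G.s (appendSeq l x 0) = u := by
  cases l with
  | nil => cases h; rw [appendSeq_nil]; exact hv.symm
  | cons e l => rw [appendSeq_cons_zero]; exact h.1

theorem IsWalk.appendSeq_chain {l : List E} {u v : V} (h : G.IsWalk u l v) (x : ℕ → E)
    (hx : ∀ i, G.r (x i) = G.s (x (i + 1))) (hv : v = G.s (x 0)) (i : ℕ) :
    G.r (appendSeq l x i) = G.s (appendSeq l x (i + 1)) := by
  induction l generalizing u i with
  | nil => rw [appendSeq_nil]; exact hx i
  | cons e l ih =>
    cases i with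
    | zero =>
      rw [appendSeq_cons_zero, appendSeq_cons_succ]
      exact (h.2.appendSeq_source x hv).symm
    | succ i =>
      rw [appendSeq_cons_succ, appendSeq_cons_succ]
      exact ih h.2 i

/-- The concatenation `μx` of a finite path `μ` with an element `x` of `Ω_G`. -/
def FinitePath.concat (μ : G.FinitePath) : (x : G.BoundaryPath) → μ.target = x.source →
    G.BoundaryPath
  | .infinite p, h => .infinite
      ⟨appendSeq μ.edges p.edges, fun i => μ.isWalk.appendSeq_chain p.edges p.chain h i⟩
  | .finite p hp, h => .finite
      ⟨μ.source, μ.edges ++ p.edges, p.target,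
        μ.isWalk.append (by rw [show μ.target = p.source from h]; exact p.isWalk)⟩ hp

/-- The cylinder set `Z(μ)`; it is `{q | s(q) = v}` when `μ` is a vertex `v`. -/
def cylinder (μ : G.FinitePath) : Set G.BoundaryPath :=
  {q | q.source = μ.source ∧ ∀ (i : ℕ) (hi : i < μ.edges.length), q.edge? i = some μ.edges[i]}

/-- `Z_F(ν) = Z(ν) \ ⋃_{μ ∈ F} Z(μ)`. -/
def cylinderDiff (ν : G.FinitePath) (F : Finset G.FinitePath) : Set G.BoundaryPath :=
  cylinder ν \ ⋃ μ ∈ F, cylinder μ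

/-- The topology of `Ω_G`, with the sets `Z_F(ν)` as a basis. -/
instance : TopologicalSpace G.BoundaryPath :=
  TopologicalSpace.generateFrom
    {U | ∃ (ν : G.FinitePath) (F : Finset G.FinitePath), U = cylinderDiff ν F}

/-- `Ω_G` carries its Borel `σ`-algebra. -/
instance : MeasurableSpace G.BoundaryPath := borel G.BoundaryPath

instance : BorelSpace G.BoundaryPath := ⟨rfl⟩

/-- The triple `(a, k, b)` is `(μx, |μ| - |μ'|, μ'x)`. -/
def IsDecomposition (μ μ' : G.FinitePath) (x : G.BoundaryPath)
    (a : G.BoundaryPath) (k : ℤ) (b : G.BoundaryPath) : Prop :=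
  ∃ (h : μ.target = x.source) (h' : μ'.target = x.source),
    a = μ.concat x h ∧ k = (μ.length : ℤ) - (μ'.length : ℤ) ∧ b = μ'.concat x h'

variable (G) in
/-- The elements of the groupoid of the graph: the triples `(μx, |μ| - |μ'|, μ'x)`. Such a triple
has range `μx` and source `μ'x`. -/
@[ext]
structure PathGroupoid where
  range : G.BoundaryPath
  lag : ℤ
  source : G.BoundaryPath
  exists_decomposition : ∃ μ μ' x, IsDecomposition μ μ' x range lag source

/-- The set `{(μx, |μ| - |μ'|, μ'x) : μx ∈ Z_F(μ), μ'x ∈ Z_F'(μ')}`. -/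
def PathGroupoid.basicSet (μ μ' : G.FinitePath) (F F' : Finset G.FinitePath) :
    Set G.PathGroupoid :=
  {γ | (∃ x, IsDecomposition μ μ' x γ.range γ.lag γ.source) ∧
    γ.range ∈ cylinderDiff μ F ∧ γ.source ∈ cylinderDiff μ' F'}

/-- The topology of the groupoid. -/
instance : TopologicalSpace G.PathGroupoid :=
  TopologicalSpace.generateFrom
    {U | ∃ (μ μ' : G.FinitePath) (F F' : Finset G.FinitePath),
      μ.target = μ'.target ∧ U = PathGroupoid.basicSet μ μ' F F'}

/-- An open bisection: an open set on which the range and the source map are injective. -/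
def IsOpenBisection (W : Set G.PathGroupoid) : Prop :=
  IsOpen W ∧ W.InjOn PathGroupoid.range ∧ W.InjOn PathGroupoid.source

/-- The extension `F(p₁ ⋯ pₙ) = F(p₁) + ⋯ + F(pₙ)` of `F` to finite paths. -/
def FinitePath.weight (F : E → ℝ) (μ : G.FinitePath) : ℝ := (μ.edges.map F).sum

/-- The homomorphism `c_F`, with `c_F(μx, |μ| - |μ'|, μ'x) = F(μ) - F(μ')`. The value does not
depend on the decomposition, see `PathGroupoid.cocycle_eq`. -/
noncomputable def PathGroupoid.cocycle (F : E → ℝ) (γ : G.PathGroupoid) : ℝ :=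
  γ.exists_decomposition.choose.weight F - γ.exists_decomposition.choose_spec.choose.weight F

theorem FinitePath.edge?_concat_left (μ : G.FinitePath) (x : G.BoundaryPath)
    (h : μ.target = x.source) (i : ℕ) (hi : i < μ.edges.length) :
    (μ.concat x h).edge? i = some μ.edges[i] := by
  cases x with
  | infinite p => simp [concat, BoundaryPath.edge?, appendSeq, hi]
  | finite p hp =>
    show (μ.edges ++ p.edges)[i]? = _
    rw [List.getElem?_append_left hi, List.getElem?_eq_getElem hi]

theorem FinitePath.edge?_concat_right (μ : G.FinitePath) (x : G.BoundaryPath)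
    (h : μ.target = x.source) (i : ℕ) :
    (μ.concat x h).edge? (μ.edges.length + i) = x.edge? i := by
  cases x with
  | infinite p => simp [concat, BoundaryPath.edge?, appendSeq]
  | finite p hp =>
    show (μ.edges ++ p.edges)[μ.edges.length + i]? = p.edges[i]?
    rw [List.getElem?_append_right (Nat.le_add_right _ _), Nat.add_sub_cancel_left]

theorem FinitePath.sum_edge?_concat (F : E → ℝ) (μ : G.FinitePath) (x : G.BoundaryPath)
    (h : μ.target = x.source) (n : ℕ) :
    ∑ i ∈ Finset.range (μ.length + n), (((μ.concat x h).edge? i).map F).getD 0 =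
      μ.weight F + ∑ i ∈ Finset.range n, ((x.edge? i).map F).getD 0 := by
  rw [Finset.sum_range_add]
  congr 1
  · rw [FinitePath.weight, ← Fin.sum_univ_getElem, Finset.sum_range, FinitePath.length]
    have hl : (μ.edges.map F).length = μ.edges.length := List.length_map ..
    refine Fintype.sum_equiv (finCongr hl.symm) _ _ fun i => ?_
    rw [μ.edge?_concat_left x h i i.2]
    simp
  · refine Finset.sum_congr rfl fun i _ => ?_
    rw [FinitePath.length, μ.edge?_concat_right]

theorem IsDecomposition.weight_sub_eq (F : E → ℝ) {μ μ' ν ν' : G.FinitePath}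
    {x y a b : G.BoundaryPath} {k : ℤ} (h : IsDecomposition μ μ' x a k b)
    (h' : IsDecomposition ν ν' y a k b) :
    μ.weight F - μ'.weight F = ν.weight F - ν'.weight F := by
  wlog hle : μ.length ≤ ν.length generalizing μ μ' ν ν' x y
  · exact (this h' h (le_of_not_ge hle)).symm
  obtain ⟨h1, h2, ha, hk, hb⟩ := h
  obtain ⟨h1', h2', ha', hk', hb'⟩ := h'
  obtain ⟨n, hn⟩ := Nat.exists_eq_add_of_le hle
  have hn' : ν'.length = μ'.length + n := by omega
  have e1 := μ.sum_edge?_concat F x h1 n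
  have e2 := μ'.sum_edge?_concat F x h2 n
  have e3 := ν.sum_edge?_concat F y h1' 0
  have e4 := ν'.sum_edge?_concat F y h2' 0
  rw [← ha, ← hn] at e1
  rw [← hb, ← hn'] at e2
  rw [← ha', add_zero, e1] at e3
  rw [← hb', add_zero, e2] at e4
  simp at e3 e4
  linarith

theorem PathGroupoid.cocycle_eq (F : E → ℝ) (γ : G.PathGroupoid) {μ μ' : G.FinitePath}
    {x : G.BoundaryPath} (h : IsDecomposition μ μ' x γ.range γ.lag γ.source) :
    γ.cocycle F = μ.weight F - μ'.weight F :=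
  γ.exists_decomposition.choose_spec.choose_spec.choose_spec.weight_sub_eq F h

/-- `m` is a `β`-KMS measure for `F`, that is a `(𝒢, c_F)`-conformal measure with exponent `β`:
a regular Borel measure on `Ω_G` with
`m(s(W)) = ∫_{r(W)} exp(β c_F(r_W⁻¹(x))) dm(x)` for every open bisection `W`, where
`g = r_W⁻¹ : r(W) → W` is the inverse of `r : W → r(W)`. -/
def IsKMSMeasure (F : E → ℝ) (β : ℝ) (m : Measure G.BoundaryPath) : Prop :=
  m.Regular ∧ ∀ W : Set G.PathGroupoid, IsOpenBisection W →
    ∀ g : G.BoundaryPath → G.PathGroupoid, (∀ γ ∈ W, g γ.range = γ) →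
      m (PathGroupoid.source '' W) =
        ∫⁻ x in PathGroupoid.range '' W, ENNReal.ofReal (Real.exp (β * (g x).cocycle F)) ∂m

variable (G) in
/-- `P(G)` as a subset of `Ω_G`. -/
def infinitePaths : Set G.BoundaryPath := {x | ∃ p, x = .infinite p}

variable (G) in
/-- `Q(G)` as a subset of `Ω_G`: the finite paths that end in a sink or an infinite emitter. -/
def finitePaths : Set G.BoundaryPath := {x | ∃ p hp, x = .finite p hp}

/-- A harmonic `β`-KMS measure: a `β`-KMS measure with `m(Q(G)) = 0`. -/
def IsHarmonicKMSMeasure (F : E → ℝ) (β : ℝ) (m : Measure G.BoundaryPath) : Prop :=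
  IsKMSMeasure F β m ∧ m G.finitePaths = 0

variable (G) in
/-- The infinite paths that pass through each edge infinitely many times. -/
def recurrentPaths : Set G.BoundaryPath :=
  {x | ∃ p, x = .infinite p ∧ ∀ e : E, {i : ℕ | p.edges i = e}.Infinite}

variable (G) in
/-- The infinite paths that visit each vertex only finitely many times. -/
def wanderingPaths : Set G.BoundaryPath :=
  {x | ∃ p, x = .infinite p ∧ ∀ v : V, {i : ℕ | G.s (p.edges i) = v}.Finite}

/-- `m(P(G) \ P(G)_rec) = 0`. -/
def IsConservative (m : Measure G.BoundaryPath) : Prop :=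
  m (G.infinitePaths \ G.recurrentPaths) = 0

/-- `m(P(G) \ P(G)_wan) = 0`. -/
def IsDissipative (m : Measure G.BoundaryPath) : Prop :=
  m (G.infinitePaths \ G.wanderingPaths) = 0

variable (G) in
/-- The matrix `A(β)` over `V`, with entries in `[0, ∞]`. -/
noncomputable def weightMatrix (F : E → ℝ) (β : ℝ) (u w : V) : ℝ≥0∞ :=
  ∑' e : {e : E // G.s e = u ∧ G.r e = w}, ENNReal.ofReal (Real.exp (-β * F e))

open Classical in
variable (G) in
/-- The powers `A(β)ⁿ`, with the convention `0 · ∞ = 0`. -/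
noncomputable def weightMatrixPow (F : E → ℝ) (β : ℝ) : ℕ → V → V → ℝ≥0∞
  | 0, u, w => if u = w then 1 else 0
  | n + 1, u, w => ∑' v : V, G.weightMatrix F β u v * weightMatrixPow F β n v w

variable (G) in
/-- `A(β)` is recurrent: `∑ₙ A(β)ⁿ_{vv} = ∞` for some vertex `v`. -/
def IsRecurrent (F : E → ℝ) (β : ℝ) : Prop :=
  ∃ v : V, ∑' n : ℕ, G.weightMatrixPow F β n v v = ∞

variable (G) in
/-- `A(β)` is transient: `∑ₙ A(β)ⁿ_{vv} < ∞` for some vertex `v`. -/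
def IsTransient (F : E → ℝ) (β : ℝ) : Prop :=
  ∃ v : V, ∑' n : ℕ, G.weightMatrixPow F β n v v < ∞

end DirectedGraph

namespace DirectedGraph

variable {V E : Type*} {G : DirectedGraph V E}

/-! The KMS condition on the bisection of triples `(μx, |μ|, x)` gives `m(Z(μ)) = exp(-βF(μ))
m(Z(r(μ)))` (`measure_cylinder`). Since `Q(G)` is null, `m` may be moved to a measure `κ` on edge
sequences. There the identity says that deleting a first edge `e` scales `κ` by `exp(-βF(e))`
(`isMarkov_map`). Iterated, starting at `u`, being at `v` at time `n` and continuing in `T` has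
measure `A(β)ⁿ_{uv} κ(start at v, T)` (`measure_shift`). Each set `Z(v)` is compact, hence of finite
measure, although `m` itself may be infinite.

If the sums `∑ₙ A(β)ⁿ_{uv}` are finite, Borel–Cantelli shows that almost every path visits each
vertex finitely often. If they are infinite, split the paths from `r(e)` by their last passage
through `e`. These disjoint events have total measure `∑ₙ A(β)ⁿ_{r(e)s(e)} · exp(-βF(e)) · κ(start
at r(e), never e)`, which is finite, so the last factor vanishes (`measure_never_eq_zero`). Hence
almost no path from `r(e)` avoids `e` eventually, and strong connectivity carries this to every
starting vertex.

Strong connectivity also makes finiteness of the sums independent of the entry, so exactly one of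
the two cases occurs. As `m ≠ 0`, it cannot be both conservative and dissipative, and the two
implications become equivalences. -/

/-! ### Combinatorics of finite and boundary paths -/

theorem isWalk_append_iff {l l' : List E} {u w : V} :
    G.IsWalk u (l ++ l') w ↔ ∃ v, G.IsWalk u l v ∧ G.IsWalk v l' w := by
  induction l generalizing u with
  | nil => simp [IsWalk]
  | cons e l ih => simp [IsWalk, ih, and_assoc]

theorem IsWalk.target_unique {l : List E} {u v w : V} (h : G.IsWalk u l v)
    (h' : G.IsWalk u l w) : v = w := by
  induction l generalizing u with
  | nil => exact h.symm.trans h'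
  | cons e l ih => exact ih h.2 h'.2

theorem isWalk_of_chain {y : ℕ → E} (hy : ∀ i, G.r (y i) = G.s (y (i + 1))) {l : List E}
    (hl : ∀ (i : ℕ) (hi : i < l.length), y i = l[i]) :
    G.IsWalk (G.s (y 0)) l (G.s (y l.length)) := by
  induction l generalizing y with
  | nil => rfl
  | cons e l ih =>
    have h0 : y 0 = e := hl 0 (by simp)
    refine ⟨by rw [h0], ?_⟩
    have := ih (y := fun i => y (i + 1)) (fun i => hy (i + 1))
      (fun i hi => hl (i + 1) (Nat.succ_lt_succ hi))
    rw [← h0, hy 0]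
    simpa using this

theorem FinitePath.ext_of_edges {p q : G.FinitePath} (h : p.source = q.source)
    (h' : p.edges = q.edges) : p = q := by
  cases p; cases q
  subst h h'
  simpa using IsWalk.target_unique ‹_› ‹_›

/-- The path of length `0` at `v`. -/
def vertexPath (G : DirectedGraph V E) (v : V) : G.FinitePath := ⟨v, [], v, rfl⟩

namespace BoundaryPath

theorem exists_isWalk (x : G.BoundaryPath) {l : List E}
    (hl : ∀ (i : ℕ) (hi : i < l.length), x.edge? i = some l[i]) :
    ∃ w, G.IsWalk x.source l w := by
  cases x with
  | infinite p => exact ⟨_, isWalk_of_chain p.chain fun i hi => by simpa [edge?] using hl i hi⟩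
  | finite p hp =>
    have hpre : l <+: p.edges := by
      rw [List.prefix_iff_getElem?]
      intro i hi
      simpa [edge?] using hl i hi
    obtain ⟨l', hl'⟩ := hpre
    have := p.isWalk
    rw [← hl', isWalk_append_iff] at this
    obtain ⟨v, hv, -⟩ := this
    exact ⟨v, hv⟩

theorem ext_of_edge? {x y : G.BoundaryPath} (h : x.source = y.source)
    (h' : ∀ i, x.edge? i = y.edge? i) : x = y := by
  cases x with
  | infinite p =>
    cases y with
    | infinite q =>
      congr 1; ext i
      simpa [edge?] using h' i
    | finite q hq => simpa [edge?] using h' q.edges.length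
  | finite p hp =>
    cases y with
    | infinite q => simpa [edge?] using (h' p.edges.length).symm
    | finite q hq =>
      have : p = q := FinitePath.ext_of_edges h (List.ext_getElem? fun i => h' i)
      subst this; rfl

end BoundaryPath

theorem FinitePath.source_concat (μ : G.FinitePath) (x : G.BoundaryPath)
    (h : μ.target = x.source) : (μ.concat x h).source = μ.source := by
  cases x with
  | infinite p => exact μ.isWalk.appendSeq_source p.edges h
  | finite p hp => rfl

theorem vertexPath_concat {v : V} (x : G.BoundaryPath) (h : (G.vertexPath v).target = x.source) :
    (G.vertexPath v).concat x h = x := by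
  refine BoundaryPath.ext_of_edge? ?_ fun i => ?_
  · rw [FinitePath.source_concat]; exact h
  · simpa [vertexPath] using (G.vertexPath v).edge?_concat_right x h i

theorem FinitePath.concat_injective (μ : G.FinitePath) {x y : G.BoundaryPath}
    (hx : μ.target = x.source) (hy : μ.target = y.source)
    (h : μ.concat x hx = μ.concat y hy) : x = y := by
  refine BoundaryPath.ext_of_edge? (hx.symm.trans hy) fun i => ?_
  rw [← μ.edge?_concat_right x hx, h, μ.edge?_concat_right]

theorem FinitePath.concat_mem_cylinder (μ : G.FinitePath) (x : G.BoundaryPath)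
    (h : μ.target = x.source) : μ.concat x h ∈ cylinder μ :=
  ⟨μ.source_concat x h, μ.edge?_concat_left x h⟩

theorem mem_cylinder_vertexPath {v : V} {x : G.BoundaryPath} :
    x ∈ cylinder (G.vertexPath v) ↔ x.source = v := by
  simp [cylinder, vertexPath]

theorem FinitePath.exists_concat_of_infinite (μ : G.FinitePath) (p : G.InfinitePath)
    (h : BoundaryPath.infinite p ∈ cylinder μ) :
    ∃ y hy, BoundaryPath.infinite p = μ.concat y hy := by
  obtain ⟨h1, h2⟩ := h
  have h2' : ∀ (i : ℕ) (hi : i < μ.edges.length), p.edges i = μ.edges[i] := fun i hi => by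
    simpa [BoundaryPath.edge?] using h2 i hi
  have hw := isWalk_of_chain p.chain h2'
  let q : G.InfinitePath := ⟨fun i => p.edges (μ.edges.length + i), fun i => p.chain _⟩
  have ht : μ.target = (BoundaryPath.infinite q).source :=
    IsWalk.target_unique μ.isWalk (by rwa [← h1])
  refine ⟨.infinite q, ht, BoundaryPath.ext_of_edge? ?_ fun i => ?_⟩
  · rw [source_concat]; exact h1
  · rcases lt_or_ge i μ.edges.length with hi | hi
    · rw [edge?_concat_left _ _ _ _ hi]; exact h2 i hi
    · obtain ⟨j, rfl⟩ := Nat.exists_eq_add_of_le hi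
      rw [edge?_concat_right]; rfl

/-! ### Topology of the path space: cylinders and compactness -/

theorem isOpen_cylinder (μ : G.FinitePath) : IsOpen (cylinder μ) :=
  TopologicalSpace.isOpen_generateFrom_of_mem ⟨μ, ∅, by simp [cylinderDiff]⟩

theorem measurableSet_cylinder (μ : G.FinitePath) : MeasurableSet (cylinder μ) :=
  (isOpen_cylinder μ).measurableSet

theorem isOpen_setOf_edge?_eq_some (i : ℕ) (e : E) :
    IsOpen {x : G.BoundaryPath | x.edge? i = some e} := by
  have : {x : G.BoundaryPath | x.edge? i = some e} =
      ⋃ (μ : G.FinitePath) (_ : μ.edges[i]? = some e), cylinder μ := by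
    ext x
    simp only [Set.mem_ofPred_eq, Set.mem_iUnion, exists_prop]
    constructor
    · intro h
      cases x with
      | finite p hp => exact ⟨p, h, rfl, fun i hi => by simp [BoundaryPath.edge?, hi]⟩
      | infinite p =>
        have hl : ∀ (j : ℕ) (hj : j < ((List.range (i + 1)).map p.edges).length),
            p.edges j = ((List.range (i + 1)).map p.edges)[j] := fun j hj => by simp
        refine ⟨⟨_, _, _, isWalk_of_chain p.chain hl⟩, ?_, rfl, fun j hj => ?_⟩
        · simpa [BoundaryPath.edge?] using h
        · rw [← hl j hj]; rfl
    · rintro ⟨μ, hμ, hx⟩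
      obtain ⟨hi, rfl⟩ := List.getElem?_eq_some_iff.1 hμ
      exact hx.2 i hi
  rw [this]
  exact isOpen_iUnion fun μ => isOpen_iUnion fun _ => isOpen_cylinder μ

open Filter Topology

/-- Basic open sets are finite Boolean combinations of cylinders, and an ultrafilter decides each
cylinder. The reverse implication in `h` handles the cylinders that are removed. -/
theorem ultrafilter_le_nhds_of_cylinder {U : Ultrafilter G.BoundaryPath} {q : G.BoundaryPath}
    (h : ∀ ν : G.FinitePath, q ∈ cylinder ν ↔ ∀ᶠ x in (U : Filter G.BoundaryPath), x ∈ cylinder ν) :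
    (U : Filter G.BoundaryPath) ≤ 𝓝 q := by
  rw [TopologicalSpace.nhds_generateFrom]
  refine le_iInf₂ fun S hS => ?_
  obtain ⟨hq, ν, F, rfl⟩ := hS
  rw [le_principal_iff]
  have hF : ∀ᶠ x in (U : Filter G.BoundaryPath), ∀ μ ∈ F, x ∉ cylinder μ := by
    rw [eventually_all_finset]
    intro μ hμ
    rw [Ultrafilter.eventually_not, ← h]
    exact fun hqμ => hq.2 (Set.mem_biUnion hμ hqμ)
  filter_upwards [(h ν).1 hq.1, hF] with x hx hx'
  refine ⟨hx, ?_⟩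
  simpa using hx'

/-- The limit of an ultrafilter is spelled by the edges on which it concentrates. If every position
is decided, the limit is an infinite path. Otherwise it is the finite path up to the first undecided
position, and its endpoint must be singular: with finitely many, but some, edges to choose from, the
ultrafilter would select one. -/
theorem isCompact_setOf_source_eq (v : V) : IsCompact {x : G.BoundaryPath | x.source = v} := by
  classical
  rw [isCompact_iff_ultrafilter_le_nhds']
  intro U hU
  have hsrc : ∀ᶠ x in (U : Filter G.BoundaryPath), x.source = v := hU
  by_cases hall : ∀ i, ∃ e : E, ∀ᶠ x in (U : Filter G.BoundaryPath), x.edge? i = some e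
  · choose a ha using hall
    have hchain : ∀ i, G.r (a i) = G.s (a (i + 1)) := by
      intro i
      have hpre : ∀ᶠ x in (U : Filter G.BoundaryPath), ∀ j < i + 2, x.edge? j = some (a j) :=
        (Set.finite_lt_nat (i + 2)).eventually_all.2 fun j _ => ha j
      obtain ⟨x, hx⟩ := hpre.exists
      obtain ⟨w, hw⟩ := x.exists_isWalk (l := (List.range i).map a ++ [a i, a (i + 1)]) (by
        intro j hj
        rw [hx j (by simpa using hj)]
        congr 1
        have : (List.range i).map a ++ [a i, a (i + 1)] = (List.range (i + 2)).map a := by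
          simp [List.range_succ]
        simp [this])
      rw [isWalk_append_iff] at hw
      obtain ⟨u, -, -, h, -⟩ := hw
      exact h.symm
    have hs : G.s (a 0) = v := by
      obtain ⟨x, hx, hx'⟩ := (hsrc.and (ha 0)).exists
      obtain ⟨w, hw⟩ := x.exists_isWalk (l := [a 0]) (by simpa using hx')
      exact hw.1.trans hx
    refine ⟨.infinite ⟨a, hchain⟩, hs, ultrafilter_le_nhds_of_cylinder fun ν => ⟨fun h => ?_, fun h => ?_⟩⟩
    · have : ∀ᶠ x in (U : Filter G.BoundaryPath), ∀ j < ν.edges.length, x.edge? j = some (a j) :=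
        (Set.finite_lt_nat _).eventually_all.2 fun j _ => ha j
      filter_upwards [this, hsrc] with x hx hx'
      refine ⟨hx'.trans (hs.symm.trans h.1), fun i hi => ?_⟩
      rw [hx i hi]; exact h.2 i hi
    · have : ∀ᶠ x in (U : Filter G.BoundaryPath), ∀ j < ν.edges.length, x.edge? j = some (a j) :=
        (Set.finite_lt_nat _).eventually_all.2 fun j _ => ha j
      obtain ⟨x, hx, hx', hx''⟩ := (h.and (this.and hsrc)).exists
      refine ⟨hs.trans (hx''.symm.trans hx.1), fun i hi => ?_⟩
      rw [← hx.2 i hi, hx' i hi]; rfl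
  · push Not at hall
    have hn := Nat.find_spec hall
    have hlt : ∀ i < Nat.find hall, ∃ e : E,
        ∀ᶠ x in (U : Filter G.BoundaryPath), x.edge? i = some e := fun i hi => by
      simpa using Nat.find_min hall hi
    generalize Nat.find hall = n at hn hlt
    choose a ha using hlt
    let l : List E := List.ofFn fun i : Fin n => a i i.2
    have hll : l.length = n := by simp [l]
    have hl : ∀ᶠ x in (U : Filter G.BoundaryPath),
        ∀ (i : ℕ) (hi : i < l.length), x.edge? i = some l[i] := by
      have : ∀ᶠ x in (U : Filter G.BoundaryPath), ∀ i : Fin n, x.edge? i = some (a i i.2) :=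
        eventually_all.2 fun i => ha i i.2
      filter_upwards [this] with x hx i hi
      simpa [l] using hx ⟨i, by omega⟩
    obtain ⟨x₀, hx₀, hx₀'⟩ := (hl.and hsrc).exists
    obtain ⟨w, hw⟩ := x₀.exists_isWalk hx₀
    rw [hx₀'] at hw
    have hsing : w ∈ G.singularVertices := by
      by_contra hns
      simp only [singularVertices, Set.mem_ofPred_eq, not_or, Set.not_infinite] at hns
      -- A path with prefix `l` cannot stop at the non-singular vertex `w`, so its next edge lies in
      -- a finite set.
      have hex : ∀ᶠ x in (U : Filter G.BoundaryPath),
          ∃ e ∈ {e | G.s e = w}, x.edge? n = some e := by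
        filter_upwards [hl, hsrc] with x hx hxs
        rcases hxe : x.edge? n with _ | e
        · exfalso
          cases x with
          | infinite p => simp [BoundaryPath.edge?] at hxe
          | finite p hp =>
            have hpe : p.edges = l := by
              have h1 : p.edges.length ≤ n := by simpa [BoundaryPath.edge?] using hxe
              have hpre : l <+: p.edges := by
                rw [List.prefix_iff_getElem?]
                intro i hi
                simpa [BoundaryPath.edge?] using hx i hi
              exact (hpre.eq_of_length_le (by omega)).symm
            have := p.isWalk
            rw [hpe, show p.source = v from hxs] at this
            rw [this.target_unique hw] at hp
            rcases hp with hp | hp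
            · exact hns.1 hp
            · exact hp hns.2
        · obtain ⟨t, ht⟩ := x.exists_isWalk (l := l ++ [e]) (by
            intro i hi
            rcases Nat.lt_or_ge i l.length with h | h
            · rw [hx i h, List.getElem_append_left h]
            · have : i = n := by simp at hi; omega
              subst this
              rw [hxe, List.getElem_append_right h]; simp)
          rw [isWalk_append_iff, hxs] at ht
          obtain ⟨u, hu, hu', -⟩ := ht
          exact ⟨e, hu'.trans (hu.target_unique hw), rfl⟩
      have : (⋃ e ∈ {e | G.s e = w}, {x : G.BoundaryPath | x.edge? n = some e}) ∈ U := by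
        filter_upwards [hex] with x hx
        simpa using hx
      obtain ⟨e, -, he⟩ := (Ultrafilter.finite_biUnion_mem_iff hns.2).1 this
      exact (Ultrafilter.eventually_not.1 (hn e)) he
    refine ⟨.finite ⟨v, l, w, hw⟩ hsing, rfl,
      ultrafilter_le_nhds_of_cylinder fun ν => ⟨fun h => ?_, fun h => ?_⟩⟩
    · filter_upwards [hl, hsrc] with x hx hx'
      refine ⟨hx'.trans h.1, fun i hi => ?_⟩
      have h2 : l[i]? = some ν.edges[i] := h.2 i hi
      obtain ⟨hi', h3⟩ := List.getElem?_eq_some_iff.1 h2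
      rw [hx i hi', h3]
    -- A longer `ν` would decide the edge at position `n`.
    · have hle : ν.edges.length ≤ n := by
        by_contra hlt
        refine Ultrafilter.eventually_not.1 (hn (ν.edges[n]'(by omega))) ?_
        filter_upwards [h] with x hx
        exact hx.2 n (by omega)
      obtain ⟨x, hx, hx', hx''⟩ := (h.and (hl.and hsrc)).exists
      refine ⟨hx''.symm.trans hx.1, fun i hi => ?_⟩
      rw [← hx.2 i hi, hx' i (by omega)]
      exact List.getElem?_eq_getElem _

end DirectedGraph

/-! ### The KMS condition on cylinders -/

namespace DirectedGraph

variable {V E : Type*} {G : DirectedGraph V E}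

/-- The set of triples `(μx, |μ|, x)` is an open bisection. -/
theorem isOpenBisection_basicSet_vertexPath (μ : G.FinitePath) :
    IsOpenBisection (PathGroupoid.basicSet μ (G.vertexPath μ.target) ∅ ∅) := by
  refine ⟨TopologicalSpace.isOpen_generateFrom_of_mem ⟨μ, G.vertexPath μ.target, ∅, ∅, rfl, rfl⟩, ?_, ?_⟩
  · rintro γ ⟨⟨x, h, h', e1, e2, e3⟩, -⟩ δ ⟨⟨y, k, k', f1, f2, f3⟩, -⟩ hγδ
    obtain rfl : x = y := μ.concat_injective h k (e1.symm.trans (hγδ.trans f1))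
    exact PathGroupoid.ext hγδ (e2.trans f2.symm) (e3.trans f3.symm)
  · rintro γ ⟨⟨x, h, h', e1, e2, e3⟩, -⟩ δ ⟨⟨y, k, k', f1, f2, f3⟩, -⟩ hγδ
    rw [vertexPath_concat] at e3 f3
    obtain rfl : x = y := e3.symm.trans (hγδ.trans f3)
    exact PathGroupoid.ext (e1.trans f1.symm) (e2.trans f2.symm) hγδ

/-- The triple `(x, 0, x)`. -/
def PathGroupoid.unit (x : G.BoundaryPath) : G.PathGroupoid :=
  ⟨x, 0, x, G.vertexPath x.source, G.vertexPath x.source, x, rfl, rfl,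
    (vertexPath_concat x rfl).symm, by simp, (vertexPath_concat x rfl).symm⟩

theorem exists_mem_basicSet_vertexPath (μ : G.FinitePath) (x : G.BoundaryPath)
    (h : μ.target = x.source) :
    ∃ γ ∈ PathGroupoid.basicSet μ (G.vertexPath μ.target) ∅ ∅,
      γ.range = μ.concat x h ∧ γ.source = x := by
  have hd : IsDecomposition μ (G.vertexPath μ.target) x (μ.concat x h)
      ((μ.length : ℤ) - ((G.vertexPath μ.target).length : ℤ)) x :=
    ⟨h, h, rfl, rfl, (vertexPath_concat x h).symm⟩
  refine ⟨⟨_, _, _, _, _, _, hd⟩, ⟨⟨x, hd⟩, ?_, ?_⟩, rfl, rfl⟩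
  · simpa [cylinderDiff] using μ.concat_mem_cylinder x h
  · simpa [cylinderDiff, mem_cylinder_vertexPath] using h.symm

variable {F : E → ℝ} {β : ℝ} {m : Measure G.BoundaryPath}

theorem IsHarmonicKMSMeasure.ae_infinite (hm : IsHarmonicKMSMeasure F β m) :
    ∀ᵐ x ∂m, ∃ p, x = .infinite p := by
  rw [ae_iff]
  refine measure_mono_null ?_ hm.2
  intro x hx
  cases x with
  | infinite p => exact absurd ⟨p, rfl⟩ hx
  | finite p hp => exact ⟨p, hp, rfl⟩

theorem IsKMSMeasure.measure_source_lt_top (hm : IsKMSMeasure F β m) (v : V) :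
    m {x | x.source = v} < ∞ :=
  have := hm.1
  (isCompact_setOf_source_eq v).measure_lt_top

/-- On the bisection of triples `(μx, |μ|, x)` the cocycle is the constant `F(μ)`, so the KMS
integral is a constant times the measure of the range. By harmonicity it suffices to identify that
range on infinite paths. -/
theorem IsHarmonicKMSMeasure.measure_cylinder (hm : IsHarmonicKMSMeasure F β m)
    (μ : G.FinitePath) :
    m (cylinder μ) = ENNReal.ofReal (Real.exp (-β * μ.weight F)) *
      m {x | x.source = μ.target} := by
  classical
  set W := PathGroupoid.basicSet μ (G.vertexPath μ.target) ∅ ∅ with hW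
  have hb := isOpenBisection_basicSet_vertexPath μ
  let g : G.BoundaryPath → G.PathGroupoid := fun x =>
    if h : ∃ γ ∈ W, γ.range = x then h.choose else PathGroupoid.unit x
  have hg : ∀ γ ∈ W, g γ.range = γ := by
    intro γ hγ
    have h : ∃ δ ∈ W, δ.range = γ.range := ⟨γ, hγ, rfl⟩
    simp only [g, dif_pos h]
    exact hb.2.1 h.choose_spec.1 hγ h.choose_spec.2
  have key := hm.1.2 W hb g hg
  have hsrc : PathGroupoid.source '' W = {x | x.source = μ.target} := by
    ext x
    constructor
    · rintro ⟨γ, hγ, rfl⟩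
      have := hγ.2.2.1
      rwa [mem_cylinder_vertexPath] at this
    · intro hx
      obtain ⟨γ, hγ, -, h⟩ := exists_mem_basicSet_vertexPath μ x (Eq.symm hx)
      exact ⟨γ, hγ, h⟩
  have hrange : PathGroupoid.range '' W =ᵐ[m] cylinder μ := by
    filter_upwards [hm.ae_infinite] with x hx
    obtain ⟨p, rfl⟩ := hx
    refine propext ⟨?_, fun h => ?_⟩
    · rintro ⟨γ, hγ, h⟩
      have := hγ.2.1.1
      rwa [h] at this
    · obtain ⟨y, hy, h'⟩ := μ.exists_concat_of_infinite p h
      obtain ⟨γ, hγ, h, -⟩ := exists_mem_basicSet_vertexPath μ y hy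
      exact ⟨γ, hγ, h.trans h'.symm⟩
  have hint : ∫⁻ x in PathGroupoid.range '' W,
      ENNReal.ofReal (Real.exp (β * (g x).cocycle F)) ∂m =
      ENNReal.ofReal (Real.exp (β * μ.weight F)) * m (cylinder μ) := by
    have hnull : NullMeasurableSet (PathGroupoid.range '' W) m :=
      (measurableSet_cylinder μ).nullMeasurableSet.congr hrange.symm
    rw [← setLIntegral_const, ← Measure.restrict_congr_set hrange]
    refine lintegral_congr_ae ?_
    filter_upwards [ae_restrict_mem₀ hnull] with x hx
    obtain ⟨γ, hγ, rfl⟩ := hx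
    obtain ⟨x, hx⟩ := hγ.1
    rw [hg γ hγ, γ.cocycle_eq F hx]
    simp [vertexPath, FinitePath.weight]
  rw [hint, hsrc] at key
  rw [key, ← mul_assoc, ← ENNReal.ofReal_mul (Real.exp_pos _).le, ← Real.exp_add]
  simp

/-! ### The associated measure on sequences of edges -/

/-- The sequence of edges of an element of `Ω_G`, continued by `e₀` if it is finite. -/
def BoundaryPath.edgeSeq (e₀ : E) (x : G.BoundaryPath) (i : ℕ) : E := (x.edge? i).getD e₀

theorem BoundaryPath.measurable_edgeSeq [Countable E] [MeasurableSpace E]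
    (e₀ : E) : Measurable (BoundaryPath.edgeSeq (G := G) e₀) := by
  rw [measurable_pi_iff]
  intro i
  have hsome : ∀ e : E, MeasurableSet {x : G.BoundaryPath | x.edge? i = some e} := fun e =>
    (isOpen_setOf_edge?_eq_some i e).measurableSet
  refine measurable_to_countable' fun e => ?_
  have : (fun x : G.BoundaryPath => x.edgeSeq e₀ i) ⁻¹' {e} =
      {x | x.edge? i = some e} ∪ ((⋃ e', {x | x.edge? i = some e'})ᶜ ∩ {_x | e₀ = e}) := by
    ext x
    rcases h : x.edge? i with _ | e' <;> simp [BoundaryPath.edgeSeq, h]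
  rw [this]
  exact (hsome e).union ((MeasurableSet.iUnion hsome).compl.inter (MeasurableSet.const _))

/-- The sequences that start with `l`. -/
def seqCylinder (l : List E) : Set (ℕ → E) := {y | ∀ (i : ℕ) (hi : i < l.length), y i = l[i]}

theorem seqCylinder_nil : seqCylinder ([] : List E) = Set.univ := by simp [seqCylinder]

theorem mem_seqCylinder_cons {e : E} {l : List E} {y : ℕ → E} :
    y ∈ seqCylinder (e :: l) ↔ y 0 = e ∧ (fun i => y (i + 1)) ∈ seqCylinder l := by
  constructor
  · exact fun h => ⟨h 0 (by simp), fun i hi => h (i + 1) (Nat.succ_lt_succ hi)⟩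
  · rintro ⟨h, h'⟩ (_ | i) hi
    · exact h
    · exact h' i (Nat.lt_of_succ_lt_succ hi)

theorem measurableSet_seqCylinder [MeasurableSpace E] [MeasurableSingletonClass E] (l : List E) :
    MeasurableSet (seqCylinder l) := by
  have : seqCylinder l = ⋂ (i : ℕ) (hi : i < l.length), (fun y => y i) ⁻¹' {l[i]} := by
    ext y; simp [seqCylinder]
  rw [this]
  exact .iInter fun i => .iInter fun hi => measurable_pi_apply i (measurableSet_singleton _)

/-- If two cylinders meet, the longer list extends the shorter one, and the intersection is the
cylinder of the longer. -/
theorem isPiSystem_seqCylinder :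
    IsPiSystem (Set.range (seqCylinder (E := E))) := by
  rintro _ ⟨l, rfl⟩ _ ⟨l', rfl⟩ ⟨y, hy, hy'⟩
  wlog h : l.length ≤ l'.length generalizing l l'
  · rw [Set.inter_comm]; exact this (l := l') (l' := l) (hy := hy') (hy' := hy) (le_of_not_ge h)
  refine ⟨l', ?_⟩
  refine (Set.inter_eq_right.2 fun z hz i hi => ?_).symm
  rw [hz i (by omega), ← hy i hi, ← hy' i (by omega)]

theorem pi_eq_generateFrom_seqCylinder [Countable E] [MeasurableSpace E]
    [MeasurableSingletonClass E] :
    (MeasurableSpace.pi : MeasurableSpace (ℕ → E)) =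
      .generateFrom (Set.range (seqCylinder (E := E))) := by
  refine le_antisymm ?_ (MeasurableSpace.generateFrom_le ?_)
  · refine iSup_le fun i => ?_
    rw [MeasurableSpace.comap_le_iff_le_map]
    intro S _
    change MeasurableSet[.generateFrom _] ((fun y : ℕ → E => y i) ⁻¹' S)
    have : (fun y : ℕ → E => y i) ⁻¹' S =
        ⋃ (l : List E) (_ : ∃ h : i < l.length, l[i] ∈ S), seqCylinder l := by
      ext y
      simp only [Set.mem_preimage, Set.mem_iUnion, exists_prop]
      constructor
      · intro hy
        refine ⟨(List.range (i + 1)).map y, ⟨by simp, by simpa using hy⟩, fun j hj => by simp⟩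
      · rintro ⟨l, ⟨h, hl⟩, hy⟩
        rwa [hy i h]
    rw [this]
    exact .iUnion fun l => .iUnion fun _ => MeasurableSpace.measurableSet_generateFrom ⟨l, rfl⟩
  · rintro _ ⟨l, rfl⟩
    exact measurableSet_seqCylinder l

variable (G) in
/-- A measure `κ` on sequences of edges is Markov for `c : E → [0, ∞]` if it is finite on the
sequences starting at any given vertex, and removing a first edge `e` scales it by `c e`. -/
structure IsMarkov [MeasurableSpace E] (c : E → ℝ≥0∞) (κ : Measure (ℕ → E)) : Prop where
  lt_top : ∀ v, κ {y | G.s (y 0) = v} < ∞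
  measure_cons : ∀ (e : E) (T : Set (ℕ → E)), MeasurableSet T →
    κ {y | y 0 = e ∧ (fun i => y (i + 1)) ∈ T} = c e * κ {y | G.s (y 0) = G.r e ∧ y ∈ T}

theorem measurable_shift [MeasurableSpace E] (n : ℕ) : Measurable fun (y : ℕ → E) i => y (n + i) :=
  measurable_pi_iff.2 fun _ => measurable_pi_apply _

theorem measurable_tail [MeasurableSpace E] : Measurable fun (y : ℕ → E) i => y (i + 1) :=
  measurable_pi_iff.2 fun _ => measurable_pi_apply _

variable [MeasurableSpace E] [DiscreteMeasurableSpace E]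

theorem measurableSet_apply_eq (i : ℕ) (e : E) : MeasurableSet {y : ℕ → E | y i = e} :=
  measurable_pi_apply (X := fun _ : ℕ => E) i (measurableSet_singleton e)

theorem measurableSet_source_eq (i : ℕ) (v : V) : MeasurableSet {y : ℕ → E | G.s (y i) = v} :=
  measurable_pi_apply (X := fun _ : ℕ => E) i (MeasurableSet.of_discrete (s := {e | G.s e = v}))

variable [Countable E]

theorem measurableSet_source_eq_and_seqCylinder (v : V) (l : List E) :
    MeasurableSet {y : ℕ → E | G.s (y 0) = v ∧ y ∈ seqCylinder l} :=
  (measurableSet_source_eq 0 v).inter (measurableSet_seqCylinder l)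

/-- The filler `e₀` only affects `Q(G)`, which is null, so this is `measure_cylinder` in terms of
sequences. -/
theorem IsHarmonicKMSMeasure.map_seqCylinder (hm : IsHarmonicKMSMeasure F β m) (e₀ : E)
    {v w : V} {l : List E} (hl : G.IsWalk v l w) :
    m.map (BoundaryPath.edgeSeq e₀) {y | G.s (y 0) = v ∧ y ∈ seqCylinder l} =
      ENNReal.ofReal (Real.exp (-β * (l.map F).sum)) * m {x | x.source = w} := by
  rw [Measure.map_apply (BoundaryPath.measurable_edgeSeq e₀)
    (measurableSet_source_eq_and_seqCylinder v l)]
  refine Eq.trans (measure_congr ?_) (hm.measure_cylinder ⟨v, l, w, hl⟩)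
  filter_upwards [hm.ae_infinite] with x hx
  obtain ⟨p, rfl⟩ := hx
  refine propext (and_congr Iff.rfl ?_)
  change p.edges ∈ seqCylinder l ↔ _
  simp [seqCylinder, BoundaryPath.edge?]

theorem IsHarmonicKMSMeasure.map_seqCylinder_of_not_isWalk (hm : IsHarmonicKMSMeasure F β m)
    (e₀ : E) {v : V} {l : List E} (hl : ∀ w, ¬ G.IsWalk v l w) :
    m.map (BoundaryPath.edgeSeq e₀) {y | G.s (y 0) = v ∧ y ∈ seqCylinder l} = 0 := by
  rw [Measure.map_apply (BoundaryPath.measurable_edgeSeq e₀)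
    (measurableSet_source_eq_and_seqCylinder v l), measure_eq_zero_iff_ae_notMem]
  filter_upwards [hm.ae_infinite] with x hx
  obtain ⟨p, rfl⟩ := hx
  rintro ⟨rfl, h⟩
  exact hl _ (isWalk_of_chain p.chain h)

/-- For fixed `e`, both sides are measures in `T`, and finite. They agree on the π-system of
cylinders: along walks because the weights multiply, and otherwise because both vanish. -/
theorem IsHarmonicKMSMeasure.isMarkov_map (hm : IsHarmonicKMSMeasure F β m) (e₀ : E) :
    G.IsMarkov (fun e => ENNReal.ofReal (Real.exp (-β * F e)))
      (m.map (BoundaryPath.edgeSeq e₀)) := by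
  have hlt : ∀ v, m.map (BoundaryPath.edgeSeq e₀) {y | G.s (y 0) = v} < ∞ := by
    intro v
    have := hm.map_seqCylinder e₀ (v := v) (l := []) rfl
    simp only [seqCylinder_nil, Set.mem_univ, and_true] at this
    rw [this]
    exact ENNReal.mul_lt_top ENNReal.ofReal_lt_top (hm.1.measure_source_lt_top v)
  refine ⟨hlt, fun e T hT => ?_⟩
  set κ := m.map (BoundaryPath.edgeSeq e₀) with hκ
  set c := ENNReal.ofReal (Real.exp (-β * F e)) with hc
  have hmap : ∀ S, MeasurableSet S → (κ.restrict {y | y 0 = e}).map (fun y i => y (i + 1)) S =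
      κ {y | y 0 = e ∧ (fun i => y (i + 1)) ∈ S} := by
    intro S hS
    rw [Measure.map_apply measurable_tail hS, Measure.restrict_apply (measurable_tail hS)]
    congr 1; ext y; exact and_comm
  have hres : ∀ S, MeasurableSet S → (c • κ.restrict {y | G.s (y 0) = G.r e}) S =
      c * κ {y | G.s (y 0) = G.r e ∧ y ∈ S} := by
    intro S hS
    rw [Measure.smul_apply, Measure.restrict_apply hS, smul_eq_mul]
    congr 2; ext y; exact and_comm
  have hcyl : ∀ l : List E, κ {y | y 0 = e ∧ (fun i => y (i + 1)) ∈ seqCylinder l} =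
      c * κ {y | G.s (y 0) = G.r e ∧ y ∈ seqCylinder l} := by
    intro l
    have hset : {y | y 0 = e ∧ (fun i => y (i + 1)) ∈ seqCylinder l} =
        {y | G.s (y 0) = G.s e ∧ y ∈ seqCylinder (e :: l)} := by
      ext y
      simp only [Set.mem_ofPred_eq, mem_seqCylinder_cons]
      exact ⟨fun h => ⟨by rw [h.1], h⟩, fun h => h.2⟩
    rw [hset]
    by_cases hw : ∃ w, G.IsWalk (G.r e) l w
    · obtain ⟨w, hw⟩ := hw
      rw [hκ, hm.map_seqCylinder e₀ hw, hm.map_seqCylinder e₀ (l := e :: l) ⟨rfl, hw⟩, ← mul_assoc,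
        ← ENNReal.ofReal_mul (Real.exp_pos _).le, ← Real.exp_add]
      simp [mul_add]
    · rw [not_exists] at hw
      rw [hκ, hm.map_seqCylinder_of_not_isWalk e₀ hw,
        hm.map_seqCylinder_of_not_isWalk e₀ (l := e :: l) fun w h => hw w h.2, mul_zero]
  have hfin : IsFiniteMeasure ((κ.restrict {y | y 0 = e}).map (fun y i => y (i + 1))) := by
    refine ⟨?_⟩
    rw [hmap _ .univ]
    refine (measure_mono ?_).trans_lt (hlt (G.s e))
    rintro y ⟨h, -⟩
    exact congrArg G.s h
  have heq : (κ.restrict {y | y 0 = e}).map (fun y i => y (i + 1)) =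
      c • κ.restrict {y | G.s (y 0) = G.r e} := by
    refine ext_of_generate_finite _ pi_eq_generateFrom_seqCylinder isPiSystem_seqCylinder ?_ ?_
    · rintro _ ⟨l, rfl⟩
      rw [hmap _ (measurableSet_seqCylinder l), hres _ (measurableSet_seqCylinder l), hcyl]
    · rw [← seqCylinder_nil, hmap _ (measurableSet_seqCylinder _),
        hres _ (measurableSet_seqCylinder _), hcyl]
  rw [← hmap T hT, heq, hres T hT]

end DirectedGraph

/-! ### Powers of the weight matrix -/

namespace DirectedGraph

variable {V E : Type*} {G : DirectedGraph V E} {F : E → ℝ} {β : ℝ}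

/-- The left side is the contribution of one intermediate vertex to the matrix product; this
inequality is all that comparing entries requires. -/
theorem weightMatrixPow_mul_le (m n : ℕ) (u v w : V) :
    G.weightMatrixPow F β m u v * G.weightMatrixPow F β n v w ≤
      G.weightMatrixPow F β (m + n) u w := by
  induction m generalizing u with
  | zero =>
    by_cases h : u = v
    · simp [weightMatrixPow, h]
    · simp [weightMatrixPow, h]
  | succ m ih =>
    rw [Nat.add_right_comm, weightMatrixPow, weightMatrixPow,
      ← ENNReal.tsum_mul_right]
    refine ENNReal.tsum_le_tsum fun x => ?_
    rw [mul_assoc]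
    gcongr
    exact ih x

theorem weightMatrixPow_length_ne_zero {l : List E} {u v : V} (hl : G.IsWalk u l v) :
    G.weightMatrixPow F β l.length u v ≠ 0 := by
  induction l generalizing u with
  | nil => cases hl; simp [weightMatrixPow]
  | cons e l ih =>
    rw [List.length_cons, weightMatrixPow, Ne, ENNReal.tsum_eq_zero, not_forall]
    refine ⟨G.r e, mul_ne_zero ?_ (ih hl.2)⟩
    rw [weightMatrix, Ne, ENNReal.tsum_eq_zero, not_forall]
    exact ⟨⟨e, hl.1, rfl⟩, by simp [Real.exp_pos]⟩

theorem StronglyConnected.exists_weightMatrixPow_ne_zero (hG : G.StronglyConnected) (u v : V) :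
    ∃ n, G.weightMatrixPow F β n u v ≠ 0 := by
  obtain ⟨μ, rfl, rfl⟩ := hG u v
  exact ⟨_, weightMatrixPow_length_ne_zero μ.isWalk⟩

/-- Prolonging by a walk from `u` to `u'` and one from `v'` to `v` bounds a nonzero multiple of the
second series by a subseries of the first. -/
theorem StronglyConnected.tsum_weightMatrixPow_lt_top (hG : G.StronglyConnected) {u v : V}
    (h : ∑' n, G.weightMatrixPow F β n u v < ∞) (u' v' : V) :
    ∑' n, G.weightMatrixPow F β n u' v' < ∞ := by
  obtain ⟨k, hk⟩ := hG.exists_weightMatrixPow_ne_zero (F := F) (β := β) u u'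
  obtain ⟨j, hj⟩ := hG.exists_weightMatrixPow_ne_zero (F := F) (β := β) v' v
  by_contra htop
  rw [not_lt, top_le_iff] at htop
  have hle : G.weightMatrixPow F β k u u' * (∑' n, G.weightMatrixPow F β n u' v') *
      G.weightMatrixPow F β j v' v ≤ ∑' n, G.weightMatrixPow F β n u v := by
    rw [← ENNReal.tsum_mul_left, ← ENNReal.tsum_mul_right]
    calc _ ≤ ∑' n, G.weightMatrixPow F β (k + n + j) u v := by
          refine ENNReal.tsum_le_tsum fun n => ?_
          refine (mul_le_mul_left (weightMatrixPow_mul_le k n u u' v') _).trans ?_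
          exact weightMatrixPow_mul_le (k + n) j u v' v
      _ ≤ _ := ENNReal.tsum_comp_le_tsum_of_injective (f := fun n => k + n + j)
          (fun a b h => by simpa using h) fun n => G.weightMatrixPow F β n u v
  rw [htop, ENNReal.mul_top hk, ENNReal.top_mul hj, top_le_iff] at hle
  exact h.ne hle

/-! ### Markov measures: Borel–Cantelli and last passage -/

variable [MeasurableSpace E] [DiscreteMeasurableSpace E]

theorem measurableSet_never (e : E) : MeasurableSet {y : ℕ → E | ∀ i, y i ≠ e} := by
  rw [Set.ofPred_forall]
  exact .iInter fun i => (measurableSet_apply_eq i e).compl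

theorem measurableSet_only_first (e : E) :
    MeasurableSet {y : ℕ → E | y 0 = e ∧ ∀ i, y (i + 1) ≠ e} :=
  (measurableSet_apply_eq 0 e).inter (measurable_tail (measurableSet_never e))

variable [Countable E] {κ : Measure (ℕ → E)}

/-- The Markov property at time `n`. -/
theorem IsMarkov.measure_shift
    (hκ : G.IsMarkov (fun e => ENNReal.ofReal (Real.exp (-β * F e))) κ) (n : ℕ) (u v : V)
    {T : Set (ℕ → E)} (hT : MeasurableSet T) :
    κ {y | G.s (y 0) = u ∧ G.s (y n) = v ∧ (fun i => y (n + i)) ∈ T} =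
      G.weightMatrixPow F β n u v * κ {y | G.s (y 0) = v ∧ y ∈ T} := by
  classical
  induction n generalizing u with
  | zero =>
    by_cases h : u = v
    · subst h
      simp only [zero_add, weightMatrixPow, if_true, one_mul]
      congr 1; ext y; simp
    · simp only [zero_add, weightMatrixPow, if_neg h, zero_mul]
      rw [show {y : ℕ → E | G.s (y 0) = u ∧ G.s (y 0) = v ∧ y ∈ T} = ∅ from ?_, measure_empty]
      exact Set.eq_empty_of_forall_notMem fun y hy => h (hy.1.symm.trans hy.2.1)
  | succ n ih =>
    set T' : Set (ℕ → E) := {y | G.s (y n) = v ∧ (fun i => y (n + i)) ∈ T} with hT'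
    have hT'm : MeasurableSet T' := (measurableSet_source_eq n v).inter (measurable_shift n hT)
    set B := κ {y | G.s (y 0) = v ∧ y ∈ T} with hB
    have hdec : {y : ℕ → E | G.s (y 0) = u ∧ G.s (y (n + 1)) = v ∧
        (fun i => y (n + 1 + i)) ∈ T} =
        ⋃ e : {e : E // G.s e = u}, {y | y 0 = e.1 ∧ (fun i => y (i + 1)) ∈ T'} := by
      ext y
      simp only [hT', Set.mem_iUnion, Set.mem_ofPred_eq, Subtype.exists, exists_prop,
        show ∀ i, n + i + 1 = n + 1 + i from fun i => by omega]
      constructor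
      · rintro ⟨h1, h2⟩
        exact ⟨_, h1, rfl, h2⟩
      · rintro ⟨e, h1, rfl, h2⟩
        exact ⟨h1, h2⟩
    rw [hdec, measure_iUnion]
    rotate_left
    · intro e e' hne
      refine Set.disjoint_left.2 fun y hy hy' => hne (Subtype.ext (hy.1.symm.trans hy'.1))
    · exact fun e => (measurableSet_apply_eq 0 _).inter (measurable_tail hT'm)
    have hstep : ∀ e : E, κ {y | y 0 = e ∧ (fun i => y (i + 1)) ∈ T'} =
        ENNReal.ofReal (Real.exp (-β * F e)) * (G.weightMatrixPow F β n (G.r e) v * B) := by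
      intro e
      rw [hκ.measure_cons e T' hT'm, ← ih (G.r e)]
      rfl
    simp only [hstep]
    rw [weightMatrixPow, ← ENNReal.tsum_mul_right]
    -- Group the edges leaving `u` by their range, to recover the entries of `A(β)` from the sum
    -- over first edges.
    have hfib : ∀ w : V, G.weightMatrix F β u w * G.weightMatrixPow F β n w v * B =
        ∑' e : {e : {e : E // G.s e = u} // G.r e.1 = w},
          ENNReal.ofReal (Real.exp (-β * F e.1)) *
            (G.weightMatrixPow F β n (G.r e.1.1) v * B) := by
      intro w
      rw [mul_assoc, weightMatrix, ← ENNReal.tsum_mul_right]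
      rw [← (Equiv.subtypeSubtypeEquivSubtypeInter (fun e : E => G.s e = u)
        (fun e => G.r e = w)).tsum_eq]
      refine tsum_congr fun e => ?_
      rw [e.2]; rfl
    simp only [hfib]
    rw [← ENNReal.tsum_sigma]
    exact ((Equiv.sigmaFiberEquiv fun e : {e : E // G.s e = u} => G.r e.1).tsum_eq
      fun e => ENNReal.ofReal (Real.exp (-β * F e)) *
        (G.weightMatrixPow F β n (G.r e) v * B)).symm

theorem IsMarkov.ae_finite_of_tsum_lt_top [Countable V]
    (hκ : G.IsMarkov (fun e => ENNReal.ofReal (Real.exp (-β * F e))) κ)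
    (h : ∀ u v, ∑' n, G.weightMatrixPow F β n u v < ∞) :
    ∀ᵐ y ∂κ, ∀ v, {i | G.s (y i) = v}.Finite := by
  rw [ae_all_iff]
  intro v
  -- Borel–Cantelli, separately for each starting vertex: only then is the series of measures known
  -- to converge, since `κ` may be infinite.
  have hu : ∀ u, ∀ᵐ y ∂κ, {n | y ∈ {y : ℕ → E | G.s (y 0) = u ∧ G.s (y n) = v}}.Finite := by
    intro u
    refine ae_finite_setOfPred_mem ?_
    have : ∀ n, κ {y : ℕ → E | G.s (y 0) = u ∧ G.s (y n) = v} =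
        G.weightMatrixPow F β n u v * κ {y | G.s (y 0) = v} := by
      intro n
      simpa using hκ.measure_shift n u v MeasurableSet.univ
    simp only [this]
    rw [ENNReal.tsum_mul_right]
    exact (ENNReal.mul_lt_top (h u v) (hκ.lt_top v)).ne
  filter_upwards [ae_all_iff.2 hu] with y hy
  simpa using hy (G.s (y 0))

/-- The measure of the sequences that pass through `e` for the last time at time `n`. -/
theorem IsMarkov.measure_last
    (hκ : G.IsMarkov (fun e => ENNReal.ofReal (Real.exp (-β * F e))) κ) (n : ℕ) (u : V) (e : E) :
    κ {y | G.s (y 0) = u ∧ y n = e ∧ ∀ i, y (n + (i + 1)) ≠ e} =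
      G.weightMatrixPow F β n u (G.s e) * (ENNReal.ofReal (Real.exp (-β * F e)) *
        κ {y | G.s (y 0) = G.r e ∧ ∀ i, y i ≠ e}) := by
  have h := hκ.measure_shift n u (G.s e) (measurableSet_only_first e)
  have h' := hκ.measure_cons e _ (measurableSet_never e)
  simp only [Set.mem_ofPred_eq] at h h'
  rw [← h']
  convert h using 3
  · ext y
    exact ⟨fun ⟨h1, h2, h3⟩ => ⟨h1, congrArg G.s h2, h2, h3⟩, fun ⟨h1, _, h2⟩ => ⟨h1, h2⟩⟩
  · ext y
    exact ⟨fun h => ⟨congrArg G.s h.1, h⟩, fun h => h.2⟩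

/-- By decomposing with respect to the last passage through `e`. -/
theorem IsMarkov.measure_never_eq_zero
    (hκ : G.IsMarkov (fun e => ENNReal.ofReal (Real.exp (-β * F e))) κ) (e : E)
    (h : ∑' n, G.weightMatrixPow F β n (G.r e) (G.s e) = ∞) :
    κ {y | G.s (y 0) = G.r e ∧ ∀ i, y i ≠ e} = 0 := by
  set D : ℕ → Set (ℕ → E) := fun n =>
    {y | G.s (y 0) = G.r e ∧ y n = e ∧ ∀ i, y (n + (i + 1)) ≠ e}
  have hD : ∀ n, MeasurableSet (D n) := fun n =>
    (measurableSet_source_eq 0 _).inter (measurable_shift n (measurableSet_only_first e))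
  have hlast : ∀ {n k y}, y ∈ D n → n < k → y k ≠ e := by
    intro n k y hy hk
    have := hy.2.2 (k - n - 1)
    rwa [show n + (k - n - 1 + 1) = k by omega] at this
  have hdisj : Pairwise (Function.onFun Disjoint D) := by
    intro n k hnk
    refine Set.disjoint_left.2 fun y hy hy' => ?_
    rcases lt_or_gt_of_ne hnk with h | h
    · exact hlast hy h hy'.2.1
    · exact hlast hy' h hy.2.1
  -- The last-passage events are disjoint and lie in a set of finite measure.
  have hle : ∑' n, κ (D n) ≤ κ {y | G.s (y 0) = G.r e} := by
    rw [← measure_iUnion hdisj hD]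
    exact measure_mono (Set.iUnion_subset fun n y hy => hy.1)
  simp only [D, hκ.measure_last] at hle
  rw [ENNReal.tsum_mul_right, h] at hle
  by_contra hne
  rw [ENNReal.top_mul (mul_ne_zero (by simp [Real.exp_pos]) hne)] at hle
  exact (hκ.lt_top _).not_ge hle

/-- `T` consists of the sequences that eventually avoid `e`. From `r(e)` such a sequence either
never meets `e` or has a last passage, and each of these events is null. A nonzero `A(β)ⁿ` entry
then transfers nullity from `r(e)` to any vertex, because a sequence with a shift in `T` is itself
in `T`. -/
theorem IsMarkov.ae_infinite_of_tsum_eq_top [Countable V] (hG : G.StronglyConnected)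
    (hκ : G.IsMarkov (fun e => ENNReal.ofReal (Real.exp (-β * F e))) κ)
    (h : ∀ u v, ∑' n, G.weightMatrixPow F β n u v = ∞) :
    ∀ᵐ y ∂κ, ∀ e, {i | y i = e}.Infinite := by
  rw [ae_all_iff]
  intro e
  set T : Set (ℕ → E) := {y | ∃ n, ∀ i, y (n + i) ≠ e}
  have hT : MeasurableSet T := by
    simp only [T, Set.ofPred_exists]
    exact .iUnion fun n => measurable_shift n (measurableSet_never e)
  have hfin : ∀ y ∈ Tᶜ, {i | y i = e}.Infinite := by
    intro y hy
    rw [Set.infinite_iff_exists_gt]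
    intro n
    have hy' : ∀ n, ∃ i, y (n + i) = e := by simpa [T] using hy
    obtain ⟨i, hi⟩ := hy' (n + 1)
    exact ⟨_, hi, by omega⟩
  have hstart : κ {y | G.s (y 0) = G.r e ∧ y ∈ T} = 0 := by
    have h0 := hκ.measure_never_eq_zero e (h _ _)
    refine measure_mono_null (t := {y | G.s (y 0) = G.r e ∧ ∀ i, y i ≠ e} ∪
      ⋃ n, {y | G.s (y 0) = G.r e ∧ y n = e ∧ ∀ i, y (n + (i + 1)) ≠ e}) ?_
      (measure_union_null h0 (measure_iUnion_null fun n => by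
        rw [hκ.measure_last, h0, mul_zero, mul_zero]))
    rintro y ⟨hy, n, hn⟩
    -- Move the avoidance time back step by step; the first obstruction is the last passage through
    -- `e`.
    induction n with
    | zero => exact Or.inl ⟨hy, by simpa using hn⟩
    | succ n ih =>
      by_cases hyn : y n = e
      · refine Or.inr (Set.mem_iUnion.2 ⟨n, hy, hyn, fun i => ?_⟩)
        rw [show n + (i + 1) = n + 1 + i by omega]
        exact hn i
      · refine ih fun i => ?_
        rcases i with _ | i
        · exact hyn
        · rw [show n + (i + 1) = n + 1 + i by omega]
          exact hn i
  have hall : ∀ v, κ {y | G.s (y 0) = v ∧ y ∈ T} = 0 := by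
    intro v
    obtain ⟨n, hn⟩ := hG.exists_weightMatrixPow_ne_zero (F := F) (β := β) (G.r e) v
    have hs := hκ.measure_shift n (G.r e) v hT
    have h0 : κ {y | G.s (y 0) = G.r e ∧ G.s (y n) = v ∧ (fun i => y (n + i)) ∈ T} = 0 := by
      refine measure_mono_null ?_ hstart
      rintro y ⟨h1, -, k, hk⟩
      exact ⟨h1, n + k, fun i => by rw [add_assoc]; exact hk i⟩
    rw [h0] at hs
    exact (mul_eq_zero.1 hs.symm).resolve_left hn
  have hTnull : κ T = 0 := by
    refine measure_mono_null (t := ⋃ v, {y | G.s (y 0) = v ∧ y ∈ T}) (fun y hy => ?_)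
      (measure_iUnion_null hall)
    exact Set.mem_iUnion.2 ⟨_, rfl, hy⟩
  filter_upwards [measure_eq_zero_iff_ae_notMem.1 hTnull] with y hy
  exact hfin y hy

end DirectedGraph

/-! ### Return to the path space and the dichotomy -/

namespace DirectedGraph

variable {V E : Type*} {G : DirectedGraph V E} {F : E → ℝ} {β : ℝ} {m : Measure G.BoundaryPath}

theorem infinite_mem_wanderingPaths_iff {p : G.InfinitePath} :
    BoundaryPath.infinite p ∈ G.wanderingPaths ↔ ∀ v, {i | G.s (p.edges i) = v}.Finite := by
  simp [wanderingPaths]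

theorem infinite_mem_recurrentPaths_iff {p : G.InfinitePath} :
    BoundaryPath.infinite p ∈ G.recurrentPaths ↔ ∀ e, {i | p.edges i = e}.Infinite := by
  simp [recurrentPaths]

theorem IsHarmonicKMSMeasure.isDissipative_of_isTransient [Countable V] [Countable E]
    (hm : IsHarmonicKMSMeasure F β m) (hG : G.StronglyConnected) (h : G.IsTransient F β) :
    IsDissipative m := by
  obtain ⟨v, hv⟩ := h
  let _ : MeasurableSpace E := ⊤
  rw [IsDissipative, measure_eq_zero_iff_ae_notMem]
  -- Without edges there are no infinite paths, and no filler `e₀` either.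
  cases isEmpty_or_nonempty E with
  | inl hE => exact .of_forall fun x ⟨⟨p, hp⟩, _⟩ => hE.elim (p.edges 0)
  | inr hE =>
    obtain ⟨e₀⟩ := hE
    have hae := ae_of_ae_map (BoundaryPath.measurable_edgeSeq e₀).aemeasurable
      ((hm.isMarkov_map e₀).ae_finite_of_tsum_lt_top
        fun u w => hG.tsum_weightMatrixPow_lt_top hv u w)
    filter_upwards [hae] with x hx
    rintro ⟨⟨p, rfl⟩, hp⟩
    exact hp (infinite_mem_wanderingPaths_iff.2 hx)

theorem IsHarmonicKMSMeasure.isConservative_of_not_isTransient [Countable V] [Countable E]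
    (hm : IsHarmonicKMSMeasure F β m) (hG : G.StronglyConnected) (h : ¬ G.IsTransient F β) :
    IsConservative m := by
  have htop : ∀ u v, ∑' n, G.weightMatrixPow F β n u v = ∞ := by
    intro u v
    by_contra hlt
    exact h ⟨u, hG.tsum_weightMatrixPow_lt_top (lt_top_iff_ne_top.2 hlt) u u⟩
  let _ : MeasurableSpace E := ⊤
  rw [IsConservative, measure_eq_zero_iff_ae_notMem]
  cases isEmpty_or_nonempty E with
  | inl hE => exact .of_forall fun x ⟨⟨p, hp⟩, _⟩ => hE.elim (p.edges 0)
  | inr hE =>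
    obtain ⟨e₀⟩ := hE
    have hae := ae_of_ae_map (BoundaryPath.measurable_edgeSeq e₀).aemeasurable
      ((hm.isMarkov_map e₀).ae_infinite_of_tsum_eq_top hG htop)
    filter_upwards [hae] with x hx
    rintro ⟨⟨p, rfl⟩, hp⟩
    exact hp (infinite_mem_recurrentPaths_iff.2 hx)

/-- A path with both properties would use its own first edge infinitely often, yet visit the source
of that edge only finitely often. -/
theorem IsHarmonicKMSMeasure.not_isDissipative_of_isConservative
    (hm : IsHarmonicKMSMeasure F β m) (hm0 : m ≠ 0) (hc : IsConservative m) :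
    ¬ IsDissipative m := by
  intro hd
  have : (ae m).NeBot := ae_neBot.2 hm0
  obtain ⟨x, ⟨p, rfl⟩, hxc, hxd⟩ := (hm.ae_infinite.and
    ((measure_eq_zero_iff_ae_notMem.1 hc).and (measure_eq_zero_iff_ae_notMem.1 hd))).exists
  have hr : BoundaryPath.infinite p ∈ G.recurrentPaths := by
    by_contra h; exact hxc ⟨⟨p, rfl⟩, h⟩
  have hw : BoundaryPath.infinite p ∈ G.wanderingPaths := by
    by_contra h; exact hxd ⟨⟨p, rfl⟩, h⟩
  rw [infinite_mem_recurrentPaths_iff] at hr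
  rw [infinite_mem_wanderingPaths_iff] at hw
  exact hr (p.edges 0) ((hw (G.s (p.edges 0))).subset fun i hi => congrArg G.s hi)

/-- A non-zero measure forces `V` to be non-empty, hence `A(β)` is recurrent if it is not
transient. -/
theorem isRecurrent_iff_not_isTransient (hG : G.StronglyConnected) (hm0 : m ≠ 0) :
    G.IsRecurrent F β ↔ ¬ G.IsTransient F β := by
  constructor
  · rintro ⟨v, hv⟩ ⟨w, hw⟩
    exact (hG.tsum_weightMatrixPow_lt_top hw v v).ne hv
  · intro h
    have : (ae m).NeBot := ae_neBot.2 hm0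
    obtain ⟨x⟩ : Nonempty G.BoundaryPath := (ae m).nonempty_of_neBot
    refine ⟨x.source, ?_⟩
    by_contra hlt
    exact h ⟨_, lt_top_iff_ne_top.2 hlt⟩

end DirectedGraph

theorem theorem4p11 {V E : Type*} [Countable V] [Countable E] (G : DirectedGraph V E)
    (hG : G.StronglyConnected) (F : E → ℝ) (β : ℝ)
    (m : MeasureTheory.Measure G.BoundaryPath)
    (hm : DirectedGraph.IsHarmonicKMSMeasure F β m) (hm0 : m ≠ 0) :
    (DirectedGraph.IsConservative m ↔ G.IsRecurrent F β) ∧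
      (DirectedGraph.IsDissipative m ↔ G.IsTransient F β) := by
  have hd := hm.isDissipative_of_isTransient hG
  have hc := hm.isConservative_of_not_isTransient hG
  have hcd := hm.not_isDissipative_of_isConservative hm0
  rw [DirectedGraph.isRecurrent_iff_not_isTransient hG hm0]
  -- Transience gives dissipativity, its negation gives conservativity, and these exclude each
  -- other.
  tauto
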